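/- Fix an integer $n\ge 1$. A Wang tile is a unit square with labelled edges, written as a tuple $(\text{right},\text{top},\text{left},\text{bottom})$; here labels are vectors $(v_0,v_1,v_2)\in\mathbb{Z}^3$. The mirror image of $\tau=(a,b,c,d)$ through the positive diagonal is $\widehat{\tau}=(b,a,d,c)$. Let $\mathcal{T}_n$ be the set consisting of the following Wang tiles: - the white tiles $\big((1,1,i+1),(1,1,j+1),(1,1,i),(1,1,j)\big)$ for $1\le i,j\le n$; - the blue tiles $b_n^i=\big((0,0,i+1),(1,1,1),(0,0,i),(1,1,n)\big)$ for $0\le i\le n-1$, and their mirror images $\widehat{b_n^i}$; - the green tiles $g_n^i=\big((0,1,i+1),(1,1,1),(0,0,i),(1,1,n+1)\big)$ for $0\le i\le n$, and their mirror images $\widehat{g_n^i}$; - the yellow tiles $y_n^i=\big((0,1,i+1),(1,1,2),(0,1,i),(1,1,n+1)\big)$ for $1\le i\le n$, and their mirror images $\widehat{y_n^i}$; - the seven junction tiles $j_n^{k,\ell,r,s}=\big((0,k,\ell),(0,r,s),(0,s,r+n),(0,\ell,k+n)\big)$ for $(k,\ell,r,s)\in\{(0,0,0,0),(0,1,0,0),(0,0,0,1),(0,1,0,1),(1,1,0,1),(0,1,1,1),(1,1,1,1)\}$.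 The Wang shift $\Omega_n$ is the subshift of all configurations $x:\mathbb{Z}^2\to\mathcal{T}_n$ that are valid, that is, such that for every $\mathbf{m}\in\mathbb{Z}^2$ the right label of $x_{\mathbf{m}}$ equals the left label of $x_{\mathbf{m}+(1,0)}$ and the top label of $x_{\mathbf{m}}$ equals the bottom label of $x_{\mathbf{m}+(0,1)}$. **Corollary B.** For every integer $n\ge 1$, the Wang shift $\Omega_n$ is aperiodic: it is nonempty, and the shift action of $\mathbb{Z}^2$ on it, $(\sigma^{\mathbf{k}}x)_{\mathbf{m}}=x_{\mathbf{m}+\mathbf{k}}$, is free, i.e. if $\sigma^{\mathbf{k}}x=x$ for some $x\in\Omega_n$ and $\mathbf{k}\in\mathbb{Z}^2$, then $\mathbf{k}=\mathbf{0}$. -/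

import Mathlib

namespace MetallicMean

open SymbolicDynamics.FullShift

/-- A Wang tile: a unit square whose vertical edges are labelled in `I` and whose horizontal edges
are labelled in `J`; the fields are in the order (right, top, left, bottom). -/
structure WangTile (I J : Type*) where
  right : I
  top : J
  left : I
  bottom : J
  deriving DecidableEq

/-- Tiles are letters of an alphabet, hence carry the discrete topology. -/
instance (I J : Type*) : TopologicalSpace (WangTile I J) := ⊥

instance (I J : Type*) : DiscreteTopology (WangTile I J) := ⟨rfl⟩

/-- A configuration `ℤ² → T` is valid if contiguous edges of adjacent tiles have equal labels. -/
def IsValid {I J : Type*} {T : Finset (WangTile I J)} (x : ℤ × ℤ → T) : Prop :=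
  ∀ m : ℤ × ℤ, (x m).1.right = (x (m + (1, 0))).1.left ∧
    (x m).1.top = (x (m + (0, 1))).1.bottom

/-- The Wang shift of a finite set `T` of Wang tiles: the subshift of all valid configurations. -/
def wangShift {I J : Type*} (T : Finset (WangTile I J)) : Subshift T (ℤ × ℤ) where
  carrier := {x | IsValid x}
  isClosed := by
    have h (m m' : ℤ × ℤ) (P : T → T → Prop) : IsClosed {x : ℤ × ℤ → T | P (x m) (x m')} := by
      have hc : Continuous fun x : ℤ × ℤ → T => (x m, x m') :=
        (continuous_apply m).prodMk (continuous_apply m')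
      exact IsClosed.preimage hc (isClosed_discrete {p : T × T | P p.1 p.2})
    simp only [IsValid, Set.ofPred_forall]
    exact isClosed_iInter fun m =>
      (h m (m + (1, 0)) fun s t => s.1.right = t.1.left).inter
        (h m (m + (0, 1)) fun s t => s.1.top = t.1.bottom)
  mapsTo := fun g x hx m => by simpa [shift, add_assoc] using hx (g + m)

/-- A subshift is aperiodic if it is nonempty and the shift action on it is free: a group element
fixing some configuration of the subshift is the identity. -/
def IsAperiodic {A G : Type*} [TopologicalSpace A] [AddGroup G] (X : Subshift A G) : Prop :=
  X.carrier.Nonempty ∧ ∀ g : G, (∃ x ∈ X.carrier, shift g x = x) → g = 0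

/-- Edge labels are vectors in `ℤ³`; `(v₀, v₁, v₂)` is written `v₀v₁v₂` for short. -/
abbrev Label : Type := ℤ × ℤ × ℤ

/-- Tiles with edge labels in `ℤ³`. -/
abbrev Tile : Type := WangTile Label Label

/-- The mirror image of a tile through the positive diagonal. -/
def mirror (t : Tile) : Tile := ⟨t.top, t.right, t.bottom, t.left⟩

/-- The white tile with left label `11i` and bottom label `11j`. -/
def white (i j : ℤ) : Tile := ⟨(1, 1, i + 1), (1, 1, j + 1), (1, 1, i), (1, 1, j)⟩

/-- The horizontal blue stripe tile with left label `00i`. -/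
def blue (n i : ℤ) : Tile := ⟨(0, 0, i + 1), (1, 1, 1), (0, 0, i), (1, 1, n)⟩

/-- The horizontal green stripe tile with left label `00i`. -/
def green (n i : ℤ) : Tile := ⟨(0, 1, i + 1), (1, 1, 1), (0, 0, i), (1, 1, n + 1)⟩

/-- The horizontal yellow stripe tile with left label `01i`. -/
def yellow (n i : ℤ) : Tile := ⟨(0, 1, i + 1), (1, 1, 2), (0, 1, i), (1, 1, n + 1)⟩

/-- The junction tiles; `(k, l)` gives the bottom right part and `(r, s)` the top left part. -/
def junction (n k l r s : ℤ) : Tile := ⟨(0, k, l), (0, r, s), (0, s, r + n), (0, l, k + n)⟩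

/-- The `n²` white tiles. -/
noncomputable def whiteTiles (n : ℕ) : Finset Tile :=
  (Finset.Icc (1 : ℤ) n ×ˢ Finset.Icc (1 : ℤ) n).image fun p => white p.1 p.2

/-- The horizontal stripe tiles: `n` blue ones, `n + 1` green ones and `n` yellow ones. -/
noncomputable def stripeTiles (n : ℕ) : Finset Tile :=
  (Finset.Ico (0 : ℤ) n).image (blue n) ∪ (Finset.Icc (0 : ℤ) n).image (green n) ∪
    (Finset.Icc (1 : ℤ) n).image (yellow n)

/-- The seven junction tiles. -/
def junctionTiles (n : ℕ) : Finset Tile :=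
  {junction n 0 0 0 0, junction n 0 1 0 0, junction n 0 0 0 1, junction n 0 1 0 1,
    junction n 1 1 0 1, junction n 0 1 1 1, junction n 1 1 1 1}

/-- The set of metallic mean Wang tiles: white tiles, horizontal stripe tiles, vertical stripe tiles
(the mirror images of the horizontal ones) and junction tiles. -/
noncomputable def metallicTiles (n : ℕ) : Finset Tile :=
  whiteTiles n ∪ stripeTiles n ∪ (stripeTiles n).image mirror ∪ junctionTiles n

/-- The `n`-th metallic mean Wang shift. -/
noncomputable def metallicShift (n : ℕ) : Subshift (metallicTiles n) (ℤ × ℤ) := wangShift (metallicTiles n)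

end MetallicMean

namespace MetallicMean

open Finset

/-! Freeness: the first label coordinate `v₀` is constant along each row and each column, giving it
a type 0 or 1. Every tile satisfies two mirror balance equations (`Balanced`). Summed over an `M ×
M` box with `a` rows and `b` columns of type 0, they telescope to `M² - nMb - ab = O(M)` and `M² -
nMa - ab = O(M)`, so `b - a` is bounded. A period `(p, q)` with `q ≠ 0` makes the row types
`q`-periodic; boxes of side `Nq` then force `q² - naq - a² = 0`, with `a` now counted over one
period. This is impossible since `n² + 4` is not a square. The case `p ≠ 0` is the mirror image.

Existence: with `s² + ns = 1`, code the orbit of the origin under translations of the torus by `s`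
in each coordinate. Far edges carry the labels of the translated point, so adjacent tiles match by
construction. The substance is `torusTile_mem`: since `(n + s)s = 1`, a translation without
wrap-around raises the floor in a label by exactly 1. -/

theorem mem_metallicTiles_iff {n : ℕ} {t : Tile} : t ∈ metallicTiles n ↔
    (∃ i j : ℤ, 1 ≤ i ∧ i ≤ n ∧ 1 ≤ j ∧ j ≤ n ∧ t = white i j) ∨
    (∃ i : ℤ, 0 ≤ i ∧ i < n ∧ (t = blue n i ∨ t = mirror (blue n i))) ∨
    (∃ i : ℤ, 0 ≤ i ∧ i ≤ n ∧ (t = green n i ∨ t = mirror (green n i))) ∨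
    (∃ i : ℤ, 1 ≤ i ∧ i ≤ n ∧ (t = yellow n i ∨ t = mirror (yellow n i))) ∨
    t ∈ junctionTiles n := by
  have hm : ∀ s : Tile, mirror s = t ↔ t = mirror s := fun s => eq_comm
  simp only [metallicTiles, whiteTiles, stripeTiles, mem_union, mem_image, mem_product, mem_Icc,
    mem_Ico, Prod.exists]
  constructor
  · rintro (((⟨i, j, ⟨⟨h1, h2⟩, h3, h4⟩, rfl⟩ |
      ((⟨i, ⟨h1, h2⟩, rfl⟩ | ⟨i, ⟨h1, h2⟩, rfl⟩) | ⟨i, ⟨h1, h2⟩, rfl⟩)) |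
      ⟨_, ((⟨i, ⟨h1, h2⟩, rfl⟩ | ⟨i, ⟨h1, h2⟩, rfl⟩) | ⟨i, ⟨h1, h2⟩, rfl⟩), rfl⟩) | h)
    · exact .inl ⟨i, j, h1, h2, h3, h4, rfl⟩
    · exact .inr (.inl ⟨i, h1, h2, .inl rfl⟩)
    · exact .inr (.inr (.inl ⟨i, h1, h2, .inl rfl⟩))
    · exact .inr (.inr (.inr (.inl ⟨i, h1, h2, .inl rfl⟩)))
    · exact .inr (.inl ⟨i, h1, h2, .inr rfl⟩)
    · exact .inr (.inr (.inl ⟨i, h1, h2, .inr rfl⟩))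
    · exact .inr (.inr (.inr (.inl ⟨i, h1, h2, .inr rfl⟩)))
    · exact .inr (.inr (.inr (.inr h)))
  · rintro (⟨i, j, h1, h2, h3, h4, rfl⟩ | ⟨i, h1, h2, rfl | rfl⟩ | ⟨i, h1, h2, rfl | rfl⟩ |
      ⟨i, h1, h2, rfl | rfl⟩ | h)
    · exact .inl (.inl (.inl ⟨i, j, ⟨⟨h1, h2⟩, h3, h4⟩, rfl⟩))
    · exact .inl (.inl (.inr (.inl (.inl ⟨i, ⟨h1, h2⟩, rfl⟩))))
    · exact .inl (.inr ⟨_, .inl (.inl ⟨i, ⟨h1, h2⟩, rfl⟩), rfl⟩)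
    · exact .inl (.inl (.inr (.inl (.inr ⟨i, ⟨h1, h2⟩, rfl⟩))))
    · exact .inl (.inr ⟨_, .inl (.inr ⟨i, ⟨h1, h2⟩, rfl⟩), rfl⟩)
    · exact .inl (.inl (.inr (.inr ⟨i, ⟨h1, h2⟩, rfl⟩)))
    · exact .inl (.inr ⟨_, .inr ⟨i, ⟨h1, h2⟩, rfl⟩, rfl⟩)
    · exact .inr h

/-! ### Freeness of the action -/

/-- The properties of the metallic mean tiles which force aperiodicity: the types `v₀` of the row
and of the column go through each tile, the labels are bounded, and each tile satisfies two additive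
balance equations. -/
structure Balanced (n : ℤ) (t : Tile) : Prop where
  right_fst : t.right.1 = t.left.1
  top_fst : t.top.1 = t.bottom.1
  left_fst : t.left.1 = 0 ∨ t.left.1 = 1
  bottom_fst : t.bottom.1 = 0 ∨ t.bottom.1 = 1
  left_snd : |t.left.2.1| ≤ n + 2
  bottom_snd : |t.bottom.2.1| ≤ n + 2
  left_thd : |t.left.2.2| ≤ n + 2
  bottom_thd : |t.bottom.2.2| ≤ n + 2
  balance : t.right.2.2 - t.left.2.2 + (t.top.2.1 - t.bottom.2.1) =
    t.bottom.1 - (1 - t.bottom.1) * (n - t.left.1)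
  balance_mirror : t.top.2.2 - t.bottom.2.2 + (t.right.2.1 - t.left.2.1) =
    t.left.1 - (1 - t.left.1) * (n - t.bottom.1)

theorem balanced_of_mem {n : ℕ} {t : Tile} (ht : t ∈ metallicTiles n) : Balanced n t := by
  rcases mem_metallicTiles_iff.1 ht with ⟨i, j, h1, h2, h3, h4, rfl⟩ | ⟨i, h1, h2, rfl | rfl⟩ |
    ⟨i, h1, h2, rfl | rfl⟩ | ⟨i, h1, h2, rfl | rfl⟩ | h
  · constructor <;> simp only [white, abs_le] <;> first | omega | simp
  iterate 6
    constructor <;> dsimp only [blue, green, yellow, mirror] <;> (try rw [abs_le]) <;>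
      omega
  simp only [junctionTiles, mem_insert, mem_singleton] at h
  rcases h with rfl | rfl | rfl | rfl | rfl | rfl | rfl <;>
  constructor <;> simp only [junction, abs_le] <;> first | omega | simp

/-! ### Averaging the balance equations over boxes -/

theorem abs_sum_range_le {f : ℕ → ℤ} {C : ℤ} (h : ∀ i, |f i| ≤ C) (M : ℕ) :
    |∑ i ∈ range M, f i| ≤ M * C :=
  (abs_sum_le_sum_abs _ _).trans <| by
    simpa using sum_le_card_nsmul (range M) (fun i => |f i|) C fun i _ => h i

/-- Summing a balance equation over a square box leaves only boundary terms. -/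
theorem abs_box_sum_le {n C : ℤ} {c r : ℕ → ℤ} {u w : ℕ → ℕ → ℤ} (hu : ∀ i j, |u i j| ≤ C)
    (hw : ∀ i j, |w i j| ≤ C)
    (h : ∀ i j, u (i + 1) j - u i j + (w i (j + 1) - w i j) = c i - (1 - c i) * (n - r j))
    (M : ℕ) :
    |(M : ℤ) ^ 2 - n * M * ∑ i ∈ range M, (1 - c i) -
      (∑ j ∈ range M, (1 - r j)) * ∑ i ∈ range M, (1 - c i)| ≤ 4 * C * M := by
  have key : (M : ℤ) ^ 2 - n * M * ∑ i ∈ range M, (1 - c i) -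
      (∑ j ∈ range M, (1 - r j)) * ∑ i ∈ range M, (1 - c i) =
      ∑ j ∈ range M, u M j - ∑ j ∈ range M, u 0 j +
        (∑ i ∈ range M, w i M - ∑ i ∈ range M, w i 0) := by
    have h1 : ∑ i ∈ range M, ∑ j ∈ range M, (u (i + 1) j - u i j) =
        ∑ j ∈ range M, u M j - ∑ j ∈ range M, u 0 j := by
      rw [sum_comm, ← sum_sub_distrib]
      exact sum_congr rfl fun j _ => sum_range_sub (fun i => u i j) M
    have h2 : ∑ i ∈ range M, ∑ j ∈ range M, (w i (j + 1) - w i j) =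
        ∑ i ∈ range M, w i M - ∑ i ∈ range M, w i 0 := by
      rw [← sum_sub_distrib]
      exact sum_congr rfl fun i _ => sum_range_sub (w i) M
    rw [← h1, ← h2, ← sum_add_distrib]
    simp_rw [← sum_add_distrib, h, sum_sub_distrib, ← mul_sum, ← sum_mul, sum_sub_distrib, sum_const,
      card_range, nsmul_eq_mul, ← mul_sum]
    ring
  rw [key]
  have a1 := abs_le.1 (abs_sum_range_le (fun j => hu M j) M)
  have a2 := abs_le.1 (abs_sum_range_le (fun j => hu 0 j) M)
  have a3 := abs_le.1 (abs_sum_range_le (fun i => hw i M) M)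
  have a4 := abs_le.1 (abs_sum_range_le (fun i => hw i 0) M)
  rw [abs_le]
  constructor <;> linarith

theorem sum_range_mul_of_periodic {f : ℕ → ℤ} {q : ℕ} (hf : Function.Periodic f q) (N : ℕ) :
    ∑ i ∈ range (N * q), f i = N * ∑ i ∈ range q, f i := by
  induction N with
  | zero => simp
  | succ N ih =>
    have h (i : ℕ) : f (N * q + i) = f i := by
      rw [add_comm]; exact hf.nat_mul N i
    rw [add_mul, one_mul, sum_range_add, ih]
    simp_rw [h]
    push_cast
    ring

/-- A zero would make the discriminant `n² + 4` a square, strictly between `n²` and `(n + 2)²`;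
equality with `(n + 1)²` means `2n = 3`. -/
theorem metallic_form_ne_zero {n : ℕ} (hn : 1 ≤ n) {q a : ℤ} (hq : q ≠ 0) :
    q ^ 2 - n * a * q - a ^ 2 ≠ 0 := by
  intro h
  have ha : a ≠ 0 := by
    rintro rfl
    simp_all
  have h2 : (2 * q - n * a) ^ 2 = ((n : ℤ) ^ 2 + 4) * a ^ 2 := by linear_combination 4 * h
  obtain ⟨c, hc⟩ : a ∣ 2 * q - n * a := by
    rw [← Int.pow_dvd_pow_iff (n := 2) two_ne_zero, h2]
    exact dvd_mul_left _ _
  have hc2 : c ^ 2 = (n : ℤ) ^ 2 + 4 := by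
    have : a ^ 2 ≠ 0 := pow_ne_zero 2 ha
    apply mul_left_cancel₀ this
    rw [← mul_pow, ← hc, h2, mul_comm]
  rw [← sq_abs] at hc2
  have hn' : (1 : ℤ) ≤ n := by exact_mod_cast hn
  have h0 := abs_nonneg c
  have l1 : (n : ℤ) < |c| := by nlinarith
  have l2 : |c| < n + 2 := by nlinarith
  have : |c| = n + 1 := by omega
  rw [this] at hc2
  have : 2 * (n : ℤ) = 3 := by linarith
  omega

/-- Two balance equations are incompatible with periodicity of the row types. -/
theorem false_of_periodic_types {n : ℕ} (hn : 1 ≤ n) {C : ℤ} {c r : ℕ → ℤ}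
    {u w u' w' : ℕ → ℕ → ℤ} (hr : ∀ j, r j = 0 ∨ r j = 1)
    (hu : ∀ i j, |u i j| ≤ C) (hw : ∀ i j, |w i j| ≤ C)
    (hu' : ∀ i j, |u' i j| ≤ C) (hw' : ∀ i j, |w' i j| ≤ C)
    (h : ∀ i j, u (i + 1) j - u i j + (w i (j + 1) - w i j) = c i - (1 - c i) * (n - r j))
    (h' : ∀ j i, u' (j + 1) i - u' j i + (w' j (i + 1) - w' j i) = r j - (1 - r j) * (n - c i))
    {q : ℕ} (hq : q ≠ 0) (hper : Function.Periodic r q) : False := by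
  set a := ∑ j ∈ range q, (1 - r j) with ha
  have hC : 0 ≤ C := (abs_nonneg _).trans (hu 0 0)
  have hn' : (1 : ℤ) ≤ n := by exact_mod_cast hn
  have hq' : (1 : ℤ) ≤ q := by exact_mod_cast Nat.one_le_iff_ne_zero.2 hq
  have ha0 : 0 ≤ a := sum_nonneg fun j _ => by rcases hr j with h | h <;> simp [h]
  have haq : a ≤ q := by
    have : ∀ j, |1 - r j| ≤ 1 := fun j => by rcases hr j with h | h <;> simp [h]
    simpa only [mul_one] using (abs_le.1 (abs_sum_range_le this q)).2
  set D := (q : ℤ) ^ 2 - n * a * q - a ^ 2 with hD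
  have bound (N : ℕ) (hN : 1 ≤ N) : |D| * N ≤ 12 * C * q := by
    have e1 := abs_box_sum_le hu hw h (N * q)
    have e2 := abs_box_sum_le hu' hw' h' (N * q)
    have hs : ∑ j ∈ range (N * q), (1 - r j) = N * a :=
      sum_range_mul_of_periodic (f := fun j => 1 - r j) (fun j => by simp [hper j]) N
    rw [hs] at e1 e2
    set b := ∑ i ∈ range (N * q), (1 - c i)
    have hN' : (1 : ℤ) ≤ N := by exact_mod_cast hN
    push_cast at e1 e2
    have hM : (0 : ℤ) < N * q := by positivity
    have e3 : |b - N * a| ≤ 8 * C := by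
      -- Subtracting the two estimates cancels `M²` and the product term, leaving `n * M * (b - N *
      -- a)`.
      have h3 := (abs_sub _ _).trans (add_le_add e2 e1)
      have : ((N : ℤ) * q) ^ 2 - n * (N * q) * (N * a) - b * (N * a) -
          ((N * q) ^ 2 - n * (N * q) * b - N * a * b) = n * (N * q) * (b - N * a) := by ring
      rw [this, abs_mul, abs_of_pos (by positivity)] at h3
      have h4 : (N * q : ℤ) * |b - N * a| ≤ n * (N * q) * |b - N * a| := by
        have := abs_nonneg (b - N * a)
        exact mul_le_mul_of_nonneg_right (le_mul_of_one_le_left hM.le hn') this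
      have h5 : (N * q : ℤ) * |b - N * a| ≤ (N * q) * (8 * C) := by linarith
      exact le_of_mul_le_mul_left h5 hM
    have e4 : |D * N * N| ≤ 12 * C * q * N := by
      have : D * N * N = ((N : ℤ) * q) ^ 2 - n * (N * q) * (N * a) - b * (N * a) +
          (b - N * a) * (N * a) := by rw [hD]; ring
      rw [this]
      refine (abs_add_le _ _).trans ?_
      rw [abs_mul (b - N * a), abs_of_nonneg (by positivity : (0 : ℤ) ≤ N * a)]
      have h6 : |b - N * a| * (N * a) ≤ 8 * C * (N * q) := by gcongr
      linarith
    rw [abs_mul, abs_mul, abs_of_pos (by positivity : (0 : ℤ) < N)] at e4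
    exact le_of_mul_le_mul_right e4 (by positivity)
  have hD0 : 1 ≤ |D| := Int.one_le_abs (metallic_form_ne_zero hn (by positivity))
  -- As `|D| ≥ 1`, this `N` already exceeds the bound.
  have := bound (12 * C * q + 1).toNat (by
    have : 0 ≤ 12 * C * q := by positivity
    omega)
  rw [Int.toNat_of_nonneg (by positivity)] at this
  nlinarith [mul_nonneg hC (by positivity : (0 : ℤ) ≤ q)]

/-! ### Row and column types of a configuration -/

theorem const_of_forall_succ {f : ℤ → ℤ} (h : ∀ i, f (i + 1) = f i) (i : ℤ) : f i = f 0 := by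
  have : Function.Periodic f 1 := h
  simpa using this.int_mul i 0

theorem left_fst_eq {n : ℕ} {f : ℤ → ℤ → Tile} (hf : ∀ i j, f i j ∈ metallicTiles n)
    (hx : ∀ i j, (f i j).right = (f (i + 1) j).left) (i i' j : ℤ) :
    (f i j).left.1 = (f i' j).left.1 := by
  have h := const_of_forall_succ (f := fun i => (f i j).left.1)
    fun i => by rw [← hx, (balanced_of_mem (hf i j)).right_fst]
  exact (h i).trans (h i').symm

theorem bottom_fst_eq {n : ℕ} {f : ℤ → ℤ → Tile} (hf : ∀ i j, f i j ∈ metallicTiles n)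
    (hy : ∀ i j, (f i j).top = (f i (j + 1)).bottom) (i j j' : ℤ) :
    (f i j).bottom.1 = (f i j').bottom.1 := by
  have h := const_of_forall_succ (f := fun j => (f i j).bottom.1)
    fun j => by rw [← hy, (balanced_of_mem (hf i j)).top_fst]
  exact (h j).trans (h j').symm

/-- A nonzero period of a valid configuration cannot exist. -/
theorem period_eq_zero {n : ℕ} (hn : 1 ≤ n) {f : ℤ → ℤ → Tile}
    (hf : ∀ i j, f i j ∈ metallicTiles n) (hx : ∀ i j, (f i j).right = (f (i + 1) j).left)
    (hy : ∀ i j, (f i j).top = (f i (j + 1)).bottom) {p q : ℤ}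
    (h : ∀ i j, f (p + i) (q + j) = f i j) : p = 0 ∧ q = 0 := by
  have hb i j := balanced_of_mem (hf i j)
  have e1 (i j : ℕ) : (f (i + 1 : ℕ) j).left.2.2 - (f i j).left.2.2 +
      ((f i (j + 1 : ℕ)).bottom.2.1 - (f i j).bottom.2.1) =
      (f i 0).bottom.1 - (1 - (f i 0).bottom.1) * (n - (f 0 j).left.1) := by
    rw [bottom_fst_eq hf hy i 0 j, left_fst_eq hf hx 0 i j, ← (hb i j).balance, hx, hy]
    push_cast
    rfl
  have e2 (j i : ℕ) : (f i (j + 1 : ℕ)).bottom.2.2 - (f i j).bottom.2.2 +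
      ((f (i + 1 : ℕ) j).left.2.1 - (f i j).left.2.1) =
      (f 0 j).left.1 - (1 - (f 0 j).left.1) * (n - (f i 0).bottom.1) := by
    rw [bottom_fst_eq hf hy i 0 j, left_fst_eq hf hx 0 i j, ← (hb i j).balance_mirror, hx, hy]
    push_cast
    rfl
  have nat_of_int {g : ℤ → ℤ} {k : ℤ} (hg : ∀ j, g (k + j) = g j) :
      Function.Periodic (fun j : ℕ => g j) k.natAbs := by
    intro j
    dsimp only
    push_cast
    rcases abs_choice k with hk | hk <;> rw [hk]
    · rw [add_comm, hg]
    · rw [← hg, add_comm, neg_add_cancel_right]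
  constructor <;> by_contra h0
  · refine false_of_periodic_types hn (fun i => (hb i 0).bottom_fst)
      (fun j i => (hb i j).bottom_thd) (fun j i => (hb i j).left_snd)
      (fun i j => (hb i j).left_thd) (fun i j => (hb i j).bottom_snd)
      e2 e1 (Int.natAbs_ne_zero.2 h0) (nat_of_int (g := fun i => (f i 0).bottom.1) fun i => ?_)
    rw [bottom_fst_eq hf hy _ 0 (q + 0), h]
  · refine false_of_periodic_types hn (fun j => (hb 0 j).left_fst)
      (fun i j => (hb i j).left_thd) (fun i j => (hb i j).bottom_snd)
      (fun j i => (hb i j).bottom_thd) (fun j i => (hb i j).left_snd)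
      e1 e2 (Int.natAbs_ne_zero.2 h0) (nat_of_int (g := fun j => (f 0 j).left.1) fun j => ?_)
    rw [left_fst_eq hf hx 0 (p + 0), h]

/-! ### Existence of a valid configuration -/

/-- The inverse of the `n`-th metallic mean: the positive root of `s ^ 2 + n * s = 1`. -/
noncomputable def invMean (n : ℕ) : ℝ := (√((n : ℝ) ^ 2 + 4) - n) / 2

theorem invMean_sq (n : ℕ) : invMean n ^ 2 + n * invMean n = 1 := by
  have := Real.sq_sqrt (by positivity : (0 : ℝ) ≤ (n : ℝ) ^ 2 + 4)
  rw [invMean]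
  linear_combination this / 4

theorem invMean_pos (n : ℕ) : 0 < invMean n := by
  have : (n : ℝ) < √((n : ℝ) ^ 2 + 4) := Real.lt_sqrt_of_sq_lt (by linarith)
  rw [invMean]
  linarith

theorem invMean_lt_one {n : ℕ} (hn : 1 ≤ n) : invMean n < 1 := by
  have h1 := invMean_sq n
  have h2 := invMean_pos n
  have : (1 : ℝ) ≤ n := by exact_mod_cast hn
  nlinarith

/-- The label of the bottom edge of the tile coding the point `(x, y)` of the torus; the label of
the left edge is obtained by exchanging the coordinates. -/
noncomputable def torusLabel (n : ℕ) (x y : ℝ) : Label :=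
  if x < 1 - invMean n then (1, 1, ⌊(n + invMean n) * y + x⌋ + 1)
  else (0, if n + invMean n ≤ (n + invMean n) * x + y then 1 else 0, ⌊(n + invMean n) * y + x⌋)

/-- The tile coding the point `(x, y)` of the torus. -/
noncomputable def torusTile (n : ℕ) (x y : ℝ) : Tile :=
  ⟨torusLabel n y (Int.fract (x + invMean n)), torusLabel n x (Int.fract (y + invMean n)),
    torusLabel n y x, torusLabel n x y⟩

theorem mirror_torusTile (n : ℕ) (x y : ℝ) : mirror (torusTile n x y) = torusTile n y x := rfl

theorem fract_add_of_lt {x s : ℝ} (h0 : 0 ≤ x) (hs : 0 ≤ s) (h : x < 1 - s) :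
    Int.fract (x + s) = x + s :=
  Int.fract_eq_self.2 ⟨by linarith, by linarith⟩

theorem fract_add_of_le {x s : ℝ} (h1 : x < 1) (hs : s ≤ 1) (h : 1 - s ≤ x) :
    Int.fract (x + s) = x + s - 1 := by
  rw [← Int.fract_sub_one]
  exact Int.fract_eq_self.2 ⟨by linarith, by linarith⟩

/-! ### Torus tiles are metallic mean tiles -/

section

variable {n : ℕ} {x y : ℝ}

theorem torusTile_white (hn : 1 ≤ n) (hx0 : 0 ≤ x) (hy0 : 0 ≤ y)
    (hx : x < 1 - invMean n) (hy : y < 1 - invMean n) :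
    ∃ i j : ℤ, 1 ≤ i ∧ i ≤ n ∧ 1 ≤ j ∧ j ≤ n ∧ torusTile n x y = white i j := by
  have h1 := invMean_sq n
  have h2 := invMean_pos n
  have h3 := invMean_lt_one hn
  set s := invMean n with hs
  have hb : (n + s) * s = 1 := by linarith
  have bound {x y : ℝ} (hx0 : 0 ≤ x) (hy0 : 0 ≤ y) (hx : x < 1 - s) (hy : y < 1 - s) :
      0 ≤ ⌊(n + s) * x + y⌋ ∧ ⌊(n + s) * x + y⌋ < n := by
    refine ⟨Int.floor_nonneg.2 (by positivity), Int.floor_lt.2 ?_⟩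
    have : (n + s) * x ≤ (n + s) * (1 - s) := by gcongr
    push_cast
    nlinarith
  have b1 := bound hx0 hy0 hx hy
  have b2 := bound hy0 hx0 hy hx
  refine ⟨⌊(n + s) * x + y⌋ + 1, ⌊(n + s) * y + x⌋ + 1, by omega, by omega, by omega, by omega, ?_⟩
  have e1 : (n + s) * (x + s) + y = (n + s) * x + y + 1 := by linear_combination hb
  have e2 : (n + s) * (y + s) + x = (n + s) * y + x + 1 := by linear_combination hb
  simp only [torusTile, torusLabel, white, ← hs, if_pos hx, if_pos hy,
    fract_add_of_lt hx0 h2.le hx, fract_add_of_lt hy0 h2.le hy, e1, e2, Int.floor_add_one]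

/-- The colour is read off `B = (n + s) * y + x`, which lies in `[n + s - 1, n + 1)`: the thresholds
`n` and `n + s` separate blue, green and yellow. -/
theorem torusTile_stripe (hn : 1 ≤ n) (hx0 : 0 ≤ x) (hy1 : y < 1)
    (hx : x < 1 - invMean n) (hy : 1 - invMean n ≤ y) :
    (∃ i : ℤ, 0 ≤ i ∧ i < n ∧ torusTile n x y = blue n i) ∨
    (∃ i : ℤ, 0 ≤ i ∧ i ≤ n ∧ torusTile n x y = green n i) ∨
    (∃ i : ℤ, 1 ≤ i ∧ i ≤ n ∧ torusTile n x y = yellow n i) := by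
  have h1 := invMean_sq n
  have h2 := invMean_pos n
  have h3 := invMean_lt_one hn
  set s := invMean n with hs
  have hb : (n + s) * s = 1 := by linarith
  have hn0 : (0 : ℝ) < n := by exact_mod_cast hn
  have hy0 : 0 ≤ y := by linarith
  set A := (n + s) * x + y with hA
  set B := (n + s) * y + x with hB
  -- Gives `A < n` when `B < n` (blue), and `A ≥ 1 + n * x` when `B ≥ n + s` (yellow).
  have hAB : s * (B - n) - (A - n) = n * (1 - s - x) := by
    rw [hA, hB]; linear_combination (y + x) * hb - x * h1
  have hx' : (n + s) * x < (n + s) * (1 - s) := by gcongr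
  have hyl : (n + s) * (1 - s) ≤ (n + s) * y := by gcongr
  have hyu : (n + s) * y < (n + s) * 1 := by gcongr
  have A0 : 0 ≤ ⌊A⌋ := Int.floor_nonneg.2 (by positivity)
  have e1 : (n + s) * (x + s) + y = A + 1 := by linear_combination hb
  have e2 : (n + s) * (y + s - 1) + x = B + 1 - n - s := by linear_combination hb
  have c1 : n + s ≤ (n + s) * y + (x + s) ↔ n ≤ B := by
    constructor <;> intro h <;> linarith
  simp only [torusTile, torusLabel, blue, green, yellow, ← hs, if_pos hx, if_neg hy.not_gt,
    fract_add_of_lt hx0 h2.le hx, fract_add_of_le hy1 h3.le hy, e1, e2, Int.floor_add_one, c1, ← hA,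
    ← hB]
  by_cases hB1 : B < n
  · left
    have hAn : ⌊A⌋ < (n : ℤ) := Int.floor_lt.2 (by push_cast; nlinarith)
    have f1 : ⌊B⌋ = (n : ℤ) - 1 := 
      Int.floor_eq_iff.2 ⟨by push_cast; linarith, by push_cast; linarith⟩
    have f2 : ⌊B + 1 - n - s⌋ = 0 := 
      Int.floor_eq_iff.2 ⟨by push_cast; linarith, by push_cast; linarith⟩
    refine ⟨⌊A⌋, A0, hAn, ?_⟩
    rw [if_neg (by linarith), if_neg (by linarith), f1, f2]
    simp
  have hAn : ⌊A⌋ ≤ (n : ℤ) := Int.lt_add_one_iff.1 (Int.floor_lt.2 (by push_cast; linarith))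
  have f1 : ⌊B⌋ = (n : ℤ) := 
      Int.floor_eq_iff.2 ⟨by push_cast; linarith, by push_cast; linarith⟩
  right
  by_cases hB2 : B < n + s
  · left
    have f2 : ⌊B + 1 - n - s⌋ = 0 := 
      Int.floor_eq_iff.2 ⟨by push_cast; linarith, by push_cast; linarith⟩
    refine ⟨⌊A⌋, A0, hAn, ?_⟩
    rw [if_pos (by linarith), if_neg (by linarith), f1, f2]
    simp
  · right
    have A1 : 1 ≤ ⌊A⌋ := Int.le_floor.2 (by push_cast; nlinarith)
    have f2 : ⌊B + 1 - n - s⌋ = 1 := 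
      Int.floor_eq_iff.2 ⟨by push_cast; linarith, by push_cast; linarith⟩
    refine ⟨⌊A⌋, A1, hAn, ?_⟩
    rw [if_pos (by linarith), if_pos (by linarith), f1, f2]
    simp

/-- The four implications leave exactly seven truth patterns: `P`, `R` are free if `Q` and `S` hold,
and both false otherwise. -/
theorem junction_ite_mem {P Q R S : Prop} [Decidable P] [Decidable Q] [Decidable R] [Decidable S]
    (hPS : P → S) (hPQ : P → Q) (hRQ : R → Q) (hRS : R → S) :
    junction n (if P then 1 else 0) (if Q then 1 else 0) (if R then 1 else 0)
      (if S then 1 else 0) ∈ junctionTiles n := by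
  simp only [junctionTiles, mem_insert, mem_singleton]
  by_cases hQ : Q <;> by_cases hS : S
  · by_cases hP : P <;> by_cases hR : R <;> simp [hP, hQ, hR, hS]
  · simp [hQ, hS, mt hPS hS, mt hRS hS]
  · simp [hQ, hS, mt hPQ hQ, mt hRQ hQ]
  · simp [hQ, hS, mt hPQ hQ, mt hRQ hQ]

theorem torusTile_junction (hn : 1 ≤ n) (hx1 : x < 1) (hy1 : y < 1)
    (hx : 1 - invMean n ≤ x) (hy : 1 - invMean n ≤ y) : torusTile n x y ∈ junctionTiles n := by
  have h1 := invMean_sq n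
  have h2 := invMean_pos n
  have h3 := invMean_lt_one hn
  set s := invMean n with hs
  have hb : (n + s) * s = 1 := by linarith
  have hn0 : (0 : ℝ) < n := by exact_mod_cast hn
  set A := (n + s) * x + y with hA
  set B := (n + s) * y + x with hB
  have hAB : A - s * B = n * x := by rw [hA, hB]; linear_combination -y * hb
  have hBA : B - s * A = n * y := by rw [hA, hB]; linear_combination -x * hb
  have hxl : (n + s) * (1 - s) ≤ (n + s) * x := by gcongr
  have hxu : (n + s) * x < (n + s) * 1 := by gcongr
  have hyl : (n + s) * (1 - s) ≤ (n + s) * y := by gcongr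
  have hyu : (n + s) * y < (n + s) * 1 := by gcongr
  have e1 : (n + s) * (x + s - 1) + y = A + 1 - n - s := by linear_combination hb
  have e2 : (n + s) * (y + s - 1) + x = B + 1 - n - s := by linear_combination hb
  have c1 : n + s ≤ (n + s) * y + (x + s - 1) ↔ n + 1 ≤ B := by
    constructor <;> intro h <;> linarith
  have c2 : n + s ≤ (n + s) * x + (y + s - 1) ↔ n + 1 ≤ A := by
    constructor <;> intro h <;> linarith
  have floor_eq {A : ℝ} (hl : n ≤ A) (hu : A < n + s + 1) :
      ⌊A⌋ = (if n + 1 ≤ A then 1 else 0) + (n : ℤ) ∧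
      ⌊A + 1 - n - s⌋ = if n + s ≤ A then 1 else 0 := by
    constructor <;> split_ifs <;> rw [Int.floor_eq_iff] <;> push_cast <;> constructor <;> linarith
  obtain ⟨fA, gA⟩ := floor_eq (A := A) (by linarith) (by linarith)
  obtain ⟨fB, gB⟩ := floor_eq (A := B) (by linarith) (by linarith)
  have key : torusTile n x y = junction n (if n + 1 ≤ B then 1 else 0)
      (if n + s ≤ A then 1 else 0) (if n + 1 ≤ A then 1 else 0) (if n + s ≤ B then 1 else 0) := by
    simp only [torusTile, torusLabel, junction, ← hs, if_neg hx.not_gt, if_neg hy.not_gt,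
      fract_add_of_le hx1 h3.le hx, fract_add_of_le hy1 h3.le hy, e1, e2, c1, c2, ← hA, ← hB,
      fA, gA, fB, gB]
  have i1 : n + 1 ≤ A → n + s ≤ A := fun h => by linarith
  have i2 : n + 1 ≤ B → n + s ≤ B := fun h => by linarith
  -- By `hAB`, `A = s * B + n * x ≥ s * (n + 1) + n * (1 - s) = n + s`.
  have i3 : n + 1 ≤ B → n + s ≤ A := fun h => by nlinarith
  have i4 : n + 1 ≤ A → n + s ≤ B := fun h => by nlinarith
  rw [key]
  exact junction_ite_mem i2 i3 i1 i4

theorem torusTile_mem (hn : 1 ≤ n) (hx0 : 0 ≤ x) (hx1 : x < 1) (hy0 : 0 ≤ y) (hy1 : y < 1) :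
    torusTile n x y ∈ metallicTiles n := by
  rw [mem_metallicTiles_iff]
  rcases lt_or_ge x (1 - invMean n) with hx | hx <;> rcases lt_or_ge y (1 - invMean n) with hy | hy
  · exact .inl (torusTile_white hn hx0 hy0 hx hy)
  · rcases torusTile_stripe hn hx0 hy1 hx hy with ⟨i, h1, h2, h⟩ | ⟨i, h1, h2, h⟩ | ⟨i, h1, h2, h⟩
    · exact .inr (.inl ⟨i, h1, h2, .inl h⟩)
    · exact .inr (.inr (.inl ⟨i, h1, h2, .inl h⟩))
    · exact .inr (.inr (.inr (.inl ⟨i, h1, h2, .inl h⟩)))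
  · rw [← mirror_torusTile]
    rcases torusTile_stripe hn hy0 hx1 hy hx with ⟨i, h1, h2, h⟩ | ⟨i, h1, h2, h⟩ | ⟨i, h1, h2, h⟩ <;>
      rw [h]
    · exact .inr (.inl ⟨i, h1, h2, .inr rfl⟩)
    · exact .inr (.inr (.inl ⟨i, h1, h2, .inr rfl⟩))
    · exact .inr (.inr (.inr (.inl ⟨i, h1, h2, .inr rfl⟩)))
  · exact .inr (.inr (.inr (.inr (torusTile_junction hn hx1 hy1 hx hy))))

end

theorem fract_fract_add (a s : ℝ) : Int.fract (Int.fract a + s) = Int.fract (a + s) :=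
  Int.fract_eq_fract.2 ⟨-⌊a⌋, by rw [Int.fract]; push_cast; ring⟩

/-- The coding of the orbit of the origin under the translations by `invMean n`. -/
noncomputable def torusConfig {n : ℕ} (hn : 1 ≤ n) (m : ℤ × ℤ) : metallicTiles n :=
  ⟨torusTile n (Int.fract (m.1 * invMean n)) (Int.fract (m.2 * invMean n)),
    torusTile_mem hn (Int.fract_nonneg _) (Int.fract_lt_one _) (Int.fract_nonneg _)
      (Int.fract_lt_one _)⟩

theorem isValid_torusConfig {n : ℕ} (hn : 1 ≤ n) : IsValid (torusConfig hn) := by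
  intro m
  constructor <;>
    simp [torusConfig, torusTile, fract_fract_add, add_mul]

end MetallicMean

theorem corollaryB (n : ℕ) (hn : 1 ≤ n) :
    MetallicMean.IsAperiodic (MetallicMean.metallicShift n) := by
  refine ⟨⟨MetallicMean.torusConfig hn, MetallicMean.isValid_torusConfig hn⟩, ?_⟩
  rintro ⟨p, q⟩ ⟨x, hx, hper⟩
  have hv : MetallicMean.IsValid x := hx
  have h := MetallicMean.period_eq_zero hn (f := fun i j => (x (i, j)).1) (p := p) (q := q)
    (fun i j => (x (i, j)).2) (fun i j => by simpa using (hv (i, j)).1)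
    (fun i j => by simpa using (hv (i, j)).2)
    (fun i j => congrArg Subtype.val (congrFun hper (i, j)))
  exact Prod.ext h.1 h.2
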